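/- Let $n\ge k\ge 1$ be integers. An ordered partition of $[n]=\{1,\dots,n\}$ into $k$ blocks is a sequence $\pi=B_1/B_2/\cdots/B_k$ of pairwise disjoint nonempty sets with union $[n]$. The opener and the closer of a block are its least and its greatest element; $\operatorname{open}\pi$ and $\operatorname{clos}\pi$ are the sets of openers and of closers of the blocks of $\pi$. The type of $\pi$ is $\lambda(\pi)=(\mathcal O(\pi),\mathcal C(\pi),\mathcal S(\pi),\mathcal T(\pi))$, where $\mathcal O(\pi)$ and $\mathcal C(\pi)$ are the sets of least and of greatest elements of the non-singleton blocks, $\mathcal S(\pi)$ is the set of elements of singleton blocks, and $\mathcal T(\pi)$ is the set of remaining elements of $[n]$. Let $w_i$ be the index of the block containing $i$, and set $$\operatorname{ros}\pi=\sum_{i=1}^n\#\{j\in\operatorname{open}\pi: j<i,\ w_j>w_i\},\qquad \operatorname{lob}\pi=\sum_{i=1}^n\#\{j\in\operatorname{open}\pi: j>i,\ w_j<w_i\},$$ $$\operatorname{lcs}\pi=\sum_{i=1}^n\#\{j\in\operatorname{clos}\pi: j<i,\ w_j<w_i\},\qquad \operatorname{rcb}\pi=\sum_{i=1}^n\#\{j\in\operatorname{clos}\pi: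 j>i,\ w_j>w_i\},$$ $$\operatorname{lsb}\pi=\sum_{i=1}^n\#\{a: a<w_i,\ \min B_a<i<\max B_a\}.$$ Put $\mathrm{MAK}=\operatorname{ros}+\operatorname{lcs}$ and $\mathrm{MAK}'=\operatorname{lob}+\operatorname{rcb}$. Write $B_i\succ B_j$ if $\min B_i>\max B_j$. Let $\operatorname{bInv}\pi$ be the number of pairs $i<j$ with $B_i\succ B_j$, and $\operatorname{bMaj}\pi$ the sum of all $i\in\{1,\dots,k-1\}$ with $B_i\succ B_{i+1}$. Finally let $$\operatorname{cinvLSB}=\operatorname{lsb}+\Big(\tbinom k2-\operatorname{bInv}\Big)+\tbinom k2,\qquad \operatorname{cmajLSB}=\operatorname{lsb}+\Big(\tbinom k2-\operatorname{bMaj}\Big)+\tbinom k2.$$ **Theorem.** For every $n\ge k\ge1$ and every type $\lambda$, the triples of statistics $(\mathrm{MAK}+\operatorname{bMaj},\ \mathrm{MAK}'+\operatorname{bMaj},\ \operatorname{cmajLSB})$ and $(\mathrm{MAK}+\operatorname{bInv},\ \mathrm{MAK}'+\operatorname{bInv},\ \operatorname{cinvLSB})$ are equidistributed on the set of ordered partitions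 of $[n]$ into $k$ blocks of type $\lambda$; that is, each triple of values is taken by the two triples of statistics on equally many such partitions. -/

import Mathlib

open Finset

/-- An ordered partition `B₁/B₂/⋯/B_k` of `[n] = {1, …, n}` into `k` blocks: a sequence of `k`
nonempty, pairwise disjoint sets whose union is `[n]`. The block `B_j` is
`block a` with `a : Fin k` and `j = a + 1`. -/
@[ext]
structure OrderedSetPartition (n k : ℕ) where
  block : Fin k → Finset ℕ
  nonempty : ∀ a, (block a).Nonempty
  disjoint : ∀ a b, a ≠ b → Disjoint (block a) (block b)
  union : Finset.univ.biUnion block = Finset.Icc 1 n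

namespace OrderedSetPartition

variable {n k : ℕ}

theorem block_subset (π : OrderedSetPartition n k) (a : Fin k) :
    π.block a ⊆ Finset.Icc 1 n := by
  rw [← π.union]
  exact Finset.subset_biUnion_of_mem π.block (Finset.mem_univ a)

noncomputable instance : Fintype (OrderedSetPartition n k) :=
  Fintype.ofInjective
    (fun π (a : Fin k) =>
      (⟨π.block a, Finset.mem_powerset.2 (π.block_subset a)⟩ :
        {s : Finset ℕ // s ∈ (Finset.Icc 1 n).powerset}))
    (fun π ρ h => by
      ext1
      funext a
      exact congrArg Subtype.val (congrFun h a))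

/-- The opener (least element) of a block. -/
def opener (π : OrderedSetPartition n k) (a : Fin k) : ℕ := (π.block a).min' (π.nonempty a)

/-- The closer (greatest element) of a block. -/
def closer (π : OrderedSetPartition n k) (a : Fin k) : ℕ := (π.block a).max' (π.nonempty a)

/-- The set `open π` of openers of the blocks. -/
def openers (π : OrderedSetPartition n k) : Finset ℕ := Finset.univ.image π.opener

/-- The set `clos π` of closers of the blocks. -/
def closers (π : OrderedSetPartition n k) : Finset ℕ := Finset.univ.image π.closer

/-- Least elements of the non-singleton blocks. -/
def strictOpeners (π : OrderedSetPartition n k) : Finset ℕ :=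
  {i ∈ Finset.Icc 1 n | ∃ a, 1 < #(π.block a) ∧ i = π.opener a}

/-- Greatest elements of the non-singleton blocks. -/
def strictClosers (π : OrderedSetPartition n k) : Finset ℕ :=
  {i ∈ Finset.Icc 1 n | ∃ a, 1 < #(π.block a) ∧ i = π.closer a}

/-- Elements of the singleton blocks. -/
def singletons (π : OrderedSetPartition n k) : Finset ℕ :=
  {i ∈ Finset.Icc 1 n | ∃ a, π.block a = {i}}

/-- Non-extremal elements of the non-singleton blocks. -/
def transients (π : OrderedSetPartition n k) : Finset ℕ :=
  {i ∈ Finset.Icc 1 n |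
    ∃ a, 1 < #(π.block a) ∧ i ∈ π.block a ∧ i ≠ π.opener a ∧ i ≠ π.closer a}

/-- The type `λ(π)`: strict openers, strict closers, singletons, transients. -/
def type (π : OrderedSetPartition n k) : Finset ℕ × Finset ℕ × Finset ℕ × Finset ℕ :=
  (π.strictOpeners, π.strictClosers, π.singletons, π.transients)

/-- `w_i < w_j`: the block containing `i` is strictly to the left of the block containing `j`. -/
def LeftOf (π : OrderedSetPartition n k) (i j : ℕ) : Prop :=
  ∃ a b : Fin k, i ∈ π.block a ∧ j ∈ π.block b ∧ a < b

instance (π : OrderedSetPartition n k) (i j : ℕ) : Decidable (π.LeftOf i j) := by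
  unfold LeftOf; infer_instance

/-- `ros = ∑ᵢ #{j ∈ open π | j < i, w_j > w_i}` (right, opener, smaller). -/
def ros (π : OrderedSetPartition n k) : ℕ :=
  ∑ i ∈ Finset.Icc 1 n, #{j ∈ π.openers | j < i ∧ π.LeftOf i j}

/-- `lob = ∑ᵢ #{j ∈ open π | j > i, w_j < w_i}` (left, opener, bigger). -/
def lob (π : OrderedSetPartition n k) : ℕ :=
  ∑ i ∈ Finset.Icc 1 n, #{j ∈ π.openers | i < j ∧ π.LeftOf j i}

/-- `lcs = ∑ᵢ #{j ∈ clos π | j < i, w_j < w_i}` (left, closer, smaller). -/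
def lcs (π : OrderedSetPartition n k) : ℕ :=
  ∑ i ∈ Finset.Icc 1 n, #{j ∈ π.closers | j < i ∧ π.LeftOf j i}

/-- `rcb = ∑ᵢ #{j ∈ clos π | j > i, w_j > w_i}` (right, closer, bigger). -/
def rcb (π : OrderedSetPartition n k) : ℕ :=
  ∑ i ∈ Finset.Icc 1 n, #{j ∈ π.closers | i < j ∧ π.LeftOf i j}

/-- `lsb = ∑ᵢ lsbᵢ`, where `lsbᵢ` counts the blocks to the left of the block containing `i`
whose opener is smaller than `i` and whose closer is greater than `i`. -/
def lsb (π : OrderedSetPartition n k) : ℕ :=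
  ∑ i ∈ Finset.Icc 1 n,
    #{a : Fin k | (∃ b, i ∈ π.block b ∧ a < b) ∧ π.opener a < i ∧ i < π.closer a}

/-- The block order `B_a ≻ B_b`: `min B_a > max B_b`. -/
def BlockGT (π : OrderedSetPartition n k) (a b : Fin k) : Prop := π.closer b < π.opener a

instance (π : OrderedSetPartition n k) (a b : Fin k) : Decidable (π.BlockGT a b) := by
  unfold BlockGT; infer_instance

/-- The number of block inversions. -/
def bInv (π : OrderedSetPartition n k) : ℕ :=
  #{p : Fin k × Fin k | p.1 < p.2 ∧ π.BlockGT p.1 p.2}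

/-- The sum of the block descents: positions `j` (counted from `1`) with `B_j ≻ B_{j+1}`. -/
def bMaj (π : OrderedSetPartition n k) : ℕ :=
  ∑ a ∈ Finset.univ.filter (fun a : Fin k => ∃ b : Fin k, (b : ℕ) = (a : ℕ) + 1 ∧ π.BlockGT a b),
    ((a : ℕ) + 1)

/-- `cbInv = (k choose 2) - bInv`, as an integer. -/
def cbInv (π : OrderedSetPartition n k) : ℤ := (k.choose 2 : ℤ) - π.bInv

/-- `cbMaj = (k choose 2) - bMaj`, as an integer. -/
def cbMaj (π : OrderedSetPartition n k) : ℤ := (k.choose 2 : ℤ) - π.bMaj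

def cinvLSB (π : OrderedSetPartition n k) : ℤ := π.lsb + π.cbInv + k.choose 2

def cmajLSB (π : OrderedSetPartition n k) : ℤ := π.lsb + π.cbMaj + k.choose 2

def MAK (π : OrderedSetPartition n k) : ℕ := π.ros + π.lcs

def MAK' (π : OrderedSetPartition n k) : ℕ := π.lob + π.rcb

end OrderedSetPartition

/-- The set of ordered partitions of `[n]` into `k` blocks that have type `lam`. -/
noncomputable def orderedPartitionsOfType (n k : ℕ)
    (lam : Finset ℕ × Finset ℕ × Finset ℕ × Finset ℕ) : Finset (OrderedSetPartition n k) :=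
  {π | π.type = lam}

/-- Two statistics are equidistributed on a finite set if they take each value equally often. -/
def Equidistributed {α β : Type*} [DecidableEq β] (s : Finset α) (f g : α → β) : Prop :=
  ∀ b, #{a ∈ s | f a = b} = #{a ∈ s | g a = b}

/-! Let rsb count, for each `i`, the blocks to the right of the block of `i` that are open across
`i`. Comparing openers and closers with each `i` shows that on a fixed type MAK and MAK' are
constants plus rsb, while lsb is a constant minus rsb (`MAK_eq`, `MAK'_eq`, `lsb_add_rsb`). Both
triples are therefore the same function of a single number, rsb + bMaj or rsb + bInv, and it
suffices to find a bijection, within the type, carrying the first sum to the second.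

Fixing the type fixes the openers `A` and the closers `D`, so partitions grow by adding 1, 2, …,
with unfinished ("active") blocks allowed on the way. If `n + 1` is not an opener it joins an active
block. No block comparison changes, and both sums rise by the number of active blocks to its right.
If `n + 1` is an opener, it forms a new block in one of `L + 1` slots. An active block to its right
adds one to rsb and a closed one adds one to bInv, so rsb + bInv rises by the number of all blocks
to its right. For rsb + bMaj, Carlitz insertion (`exists_insert_major`) shows that the slots again
realise each of 0, …, `L` once.

Thus both sums have the same possible increments at every step. Matching equal increments
recursively gives the bijection (`exists_equiv_invStat_majStat`). -/

namespace List

/-! ### Major index of lists and Carlitz insertion -/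

section Statistics

variable {α : Type*} (R : α → α → Prop) [DecidableRel R]

/-- The number of descents of a list: adjacent entries `x, y` with `R x y`. -/
def descents : List α → ℕ
  | [] => 0
  | [_] => 0
  | x :: y :: l => (if R x y then 1 else 0) + descents (y :: l)

/-- The major index of a list: the sum of the positions, counted from `1`, of its descents. -/
def major : List α → ℕ
  | [] => 0
  | [_] => 0
  | x :: y :: l => (if R x y then 1 else 0) + descents R (y :: l) + major (y :: l)

/-- The sum of `c x y` over all pairs of entries with `x` before `y`. -/
def pairSum (c : α → α → ℕ) : List α → ℕ
  | [] => 0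
  | x :: l => (l.map (c x)).sum + pairSum c l

variable {R}

theorem pairSum_append_cons (c : α → α → ℕ) (l₁ l₂ : List α) (x : α) :
    pairSum c (l₁ ++ x :: l₂) =
      pairSum c (l₁ ++ l₂) + ((l₁.map (c · x)).sum + (l₂.map (c x)).sum) := by
  induction l₁ with
  | nil => simp [pairSum]; omega
  | cons y l ih => simp [pairSum, ih]; omega

theorem descents_replace {x x' : α} (l₁ l₂ : List α) (h₁ : ∀ y ∈ l₁, R y x ↔ R y x')
    (h₂ : ∀ y ∈ l₂, R x y ↔ R x' y) :
    descents R (l₁ ++ x :: l₂) = descents R (l₁ ++ x' :: l₂) := by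
  induction l₁ with
  | nil =>
    cases l₂ with
    | nil => rfl
    | cons y l => simp [descents, h₂ y]
  | cons y l ih =>
    have ih := ih fun z hz => h₁ z (by simp [hz])
    cases l with
    | nil => simp_all [descents]
    | cons z l => simp_all [descents]

theorem major_replace {x x' : α} (l₁ l₂ : List α) (h₁ : ∀ y ∈ l₁, R y x ↔ R y x')
    (h₂ : ∀ y ∈ l₂, R x y ↔ R x' y) :
    major R (l₁ ++ x :: l₂) = major R (l₁ ++ x' :: l₂) := by
  induction l₁ with
  | nil =>
    cases l₂ with
    | nil => rfl
    | cons y l => simp [major, h₂ y]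
  | cons y l ih =>
    have h₁' : ∀ z ∈ l, R z x ↔ R z x' := fun z hz => h₁ z (by simp [hz])
    have ih := ih h₁'
    have hd := descents_replace l l₂ h₁' h₂
    cases l with
    | nil => simp_all [major]
    | cons z l => simp_all [major]

/-- Distinct descents end at distinct entries of `l`, and each such entry satisfies `C`. The bound
keeps the value passed to the tail in range in Carlitz insertion. -/
theorem descents_cons_add_countP_le (C : α → Prop) [DecidablePred C] (hR : ∀ x y, R x y → C y)
    (x : α) (l : List α) : descents R (x :: l) + l.countP (¬ C ·) ≤ l.length := by
  induction l generalizing x with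
  | nil => simp [descents]
  | cons y l ih =>
    have ih := ih y
    have := hR x y
    have hc : (y :: l).countP (¬ C ·) = l.countP (¬ C ·) + if C y then 0 else 1 := by
      rw [List.countP_cons]; by_cases hy : C y <;> simp [hy]
    rw [hc, descents, List.length_cons]
    split_ifs <;> first | omega | tauto

/-- Carlitz insertion: inserting into a list a new entry `b` that is `R`-related exactly to the
entries satisfying `C`, the sum of the major index and of the number of entries to the right of `b`
violating `C` is raised by every `j ≤ l.length`. The number of descents is raised only for large
`j`. -/
theorem exists_insert_major (C : α → Prop) [DecidablePred C] (b : α) (hR : ∀ x y, R x y → C y)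
    (l : List α) (hl : ∀ x ∈ l, ¬ R x b ∧ (R b x ↔ C x)) (j : ℕ) (hj : j ≤ l.length) :
    ∃ l₁ l₂, l₁ ++ l₂ = l ∧
      major R (l₁ ++ b :: l₂) + l₂.countP (¬ C ·) = major R l + j ∧
      descents R (l₁ ++ b :: l₂) =
        descents R l + if j ≤ descents R l + l.countP (¬ C ·) then 0 else 1 := by
  induction l generalizing j with
  | nil => exact ⟨[], [], rfl, by simpa [major, eq_comm] using hj, by simpa [descents] using hj⟩
  | cons x l ih =>
    have hx := hl x (by simp)
    have hl' : ∀ y ∈ l, ¬ R y b ∧ (R b y ↔ C y) := fun y hy => hl y (by simp [hy])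
    cases l with
    | nil =>
      simp at hj
      by_cases h0 : j = 0
      · exact ⟨[x], [], rfl, by simp [major, descents, hx, h0], by simp [descents, hx, h0]⟩
      · have : j = 1 := by omega
        subst this
        refine ⟨[], [x], rfl, ?_, ?_⟩ <;> by_cases hC : C x <;> simp [major, descents, hx, hC]
    | cons y l =>
      have hy := hl' y (by simp)
      have hxy := hR x y
      simp only [List.length_cons] at hj ih
      have hle := descents_cons_add_countP_le C hR y l
      have hay : (y :: l).countP (¬ C ·) ≤ l.countP (¬ C ·) + 1 := by
        rw [List.countP_cons]; split_ifs <;> omega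
      set d := descents R (y :: l) with hd
      set a := (y :: l).countP (¬ C ·) with ha
      have hax : (x :: y :: l).countP (¬ C ·) = a + if C x then 0 else 1 := by
        rw [List.countP_cons, ← ha]; by_cases hC : C x <;> simp [hC]
      have hdx : descents R (x :: y :: l) = (if R x y then 1 else 0) + d := rfl
      have hmx : major R (x :: y :: l) = (if R x y then 1 else 0) + d + major R (y :: l) := rfl
      have hdb : descents R (b :: y :: l) = (if C y then 1 else 0) + d := by simp [descents, hy, hd]
      have hmb : major R (b :: y :: l) = (if C y then 1 else 0) + d + major R (y :: l) := by
        simp [major, hy, hd]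
      rw [hax, hdx, hmx]
      -- This is the rise caused by putting `b` in front of `x`.
      by_cases h0 : j = (if R x y then 1 else 0) + d + (a + if C x then 0 else 1) +
          if C x then 1 else 0
      · refine ⟨[], x :: y :: l, rfl, ?_, ?_⟩
        · simp only [List.nil_append, hax, major, hx.2, descents, ← hd]
          split_ifs at * <;> omega
        · simp only [List.nil_append, descents, hx.2, ← hd]
          split_ifs at * <;> omega
      -- The slot between `x` and `y`: a possible descent from `x` to `y` is lost, and one from `b`
      -- to `y` would be at position 2.
      by_cases h1 : j + (if R x y then 1 else 0) = d + a + 2 * (if C y then 1 else 0)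
      · refine ⟨[x], y :: l, rfl, ?_, ?_⟩
        · simp only [List.cons_append, List.nil_append, ← ha, major, descents, hx.1, hy.2, ← hd, if_false]
          split_ifs at * <;> omega
        · simp only [List.cons_append, List.nil_append, descents, hx.1, hy.2, ← hd, if_false]
          split_ifs at * <;> first | omega | tauto
      -- Prefixing `x` shifts every descent of the tail by one, so the rise grows by one exactly
      -- when the insertion creates a descent. This is why the induction also tracks `descents`; the
      -- threshold is `d + a`.
      obtain ⟨l₁, l₂, h, hm, hdes⟩ := ih hl' (if j ≤ d + a then j else j - 1) (by
        split_ifs <;> omega)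
      cases l₁ with
      | nil =>
        -- Inserting directly before `y` would separate `x` from `y`. The values of `j` leading
        -- there are already covered by `h0` and `h1`.
        exfalso
        simp only [List.nil_append] at h
        subst h
        simp only [List.nil_append, hmb, ← ha] at hm
        split_ifs at * <;> first | omega | tauto
      | cons z l₁ =>
        obtain ⟨rfl, rfl⟩ : z = y ∧ l₁ ++ l₂ = l := by simpa using h
        refine ⟨x :: z :: l₁, l₂, rfl, ?_, ?_⟩
        · simp only [List.cons_append, major] at hm hdes ⊢
          split_ifs at * <;> first | omega | tauto
        · simp only [List.cons_append, descents] at hm hdes ⊢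
          split_ifs at * <;> omega

/-- A slot determines its rise, so choosing a slot for every rise is injective and hence a
permutation of the slots. A separate `N` lets lists of equal length share one index type. -/
theorem exists_perm_major (C : α → Prop) [DecidablePred C] (b : α) (hR : ∀ x y, R x y → C y)
    (l : List α) (hl : ∀ x ∈ l, ¬ R x b ∧ (R b x ↔ C x)) {N : ℕ} (hN : l.length + 1 = N) :
    ∃ g : Equiv.Perm (Fin N), ∀ j, major R (l.take (g j) ++ b :: l.drop (g j)) +
      (l.drop (g j)).countP (¬ C ·) = major R l + j := by
  subst hN
  have key : ∀ j : Fin (l.length + 1), ∃ p : Fin (l.length + 1),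
      major R (l.take p ++ b :: l.drop p) + (l.drop p).countP (¬ C ·) = major R l + j := by
    intro j
    obtain ⟨l₁, l₂, rfl, h, -⟩ := exists_insert_major C b hR l hl j (by omega)
    exact ⟨⟨l₁.length, by simp⟩, by simpa using h⟩
  choose g hg using key
  have hinj : Function.Injective g := fun i j hij => by
    have hi := hg i
    rw [hij, hg j] at hi
    exact Fin.ext (by omega)
  exact ⟨Equiv.ofBijective g (Finite.injective_iff_bijective.1 hinj), hg⟩

/-! ### Locating an entry of a list -/

theorem exists_split_countP (P : α → Prop) [DecidablePred P] (l : List α) (j : ℕ)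
    (hj : j < l.countP (P ·)) :
    ∃ l₁ x l₂, l = l₁ ++ x :: l₂ ∧ P x ∧ l₂.countP (P ·) = j := by
  induction l with
  | nil => simp at hj
  | cons y l ih =>
    by_cases h : j < l.countP (P ·)
    · obtain ⟨l₁, x, l₂, rfl, hx, h⟩ := ih h
      exact ⟨y :: l₁, x, l₂, rfl, hx, h⟩
    · by_cases hy : P y
      · refine ⟨[], y, l, rfl, hy, ?_⟩
        simp [hy] at hj
        omega
      · simp [hy] at hj
        omega

theorem split_countP_unique (P : α → Prop) [DecidablePred P] {l₁ l₂ l₁' l₂' : List α} {x x' : α}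
    (h : l₁ ++ x :: l₂ = l₁' ++ x' :: l₂') (hx : P x) (hx' : P x')
    (hc : l₂.countP (P ·) = l₂'.countP (P ·)) : l₁ = l₁' ∧ x = x' ∧ l₂ = l₂' := by
  induction l₁ generalizing l₁' with
  | nil =>
    cases l₁' with
    | nil => simpa using h
    | cons y l =>
      simp only [List.nil_append, List.cons_append, List.cons.injEq] at h
      rw [h.2] at hc
      simp [hx'] at hc
      omega
  | cons z l₁ ih =>
    cases l₁' with
    | nil =>
      simp only [List.nil_append, List.cons_append, List.cons.injEq] at h
      rw [← h.2] at hc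
      simp [hx] at hc
      omega
    | cons y l =>
      simp only [List.cons_append, List.cons.injEq] at h
      obtain ⟨h1, h2, h3⟩ := ih h.2
      exact ⟨by rw [h.1, h1], h2, h3⟩

/-- The marked entry is the first one satisfying `P`. With `P` saying that a block contains `n + 1`,
this recovers the place of insertion. -/
theorem split_unique (P : α → Prop) {l₁ l₂ l₁' l₂' : List α} {x x' : α}
    (h : l₁ ++ x :: l₂ = l₁' ++ x' :: l₂') (hx : P x) (hx' : P x')
    (h₁ : ∀ y ∈ l₁, ¬ P y) (h₁' : ∀ y ∈ l₁', ¬ P y) : l₁ = l₁' ∧ x = x' ∧ l₂ = l₂' := by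
  induction l₁ generalizing l₁' with
  | nil =>
    cases l₁' with
    | nil => simpa using h
    | cons y l =>
      simp only [List.nil_append, List.cons_append, List.cons.injEq] at h
      exact absurd hx (h.1 ▸ h₁' y (by simp))
  | cons z l₁ ih =>
    cases l₁' with
    | nil =>
      simp only [List.nil_append, List.cons_append, List.cons.injEq] at h
      exact absurd hx' (h.1 ▸ h₁ z (by simp))
    | cons y l =>
      simp only [List.cons_append, List.cons.injEq] at h
      obtain ⟨h1, h2, h3⟩ := ih h.2 (fun y hy => h₁ y (by simp [hy])) fun y hy => h₁' y (by simp [hy])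
      exact ⟨by rw [h.1, h1], h2, h3⟩

end Statistics

end List

/-! ### Lists of blocks

Blocks are finite sets of naturals. The set `A` prescribes which elements are openers, the set `D`
which ones are closers; a block without closer is still active. -/

namespace BlockList

/-- A block is closed if it contains a closer. -/
def Closed (D X : Finset ℕ) : Prop := ∃ t ∈ X, t ∈ D

instance (D : Finset ℕ) : DecidablePred (Closed D) := fun X => by unfold Closed; infer_instance

/-- The block order on blocks that may still be active: `Y` is closed and lies below `X`. -/
def Above (D X Y : Finset ℕ) : Prop := Closed D Y ∧ ∀ x ∈ X, ∀ y ∈ Y, y < x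

instance (D : Finset ℕ) : DecidableRel (Above D) := fun X Y => by unfold Above; infer_instance

/-- The number of elements of `X` at which the block `Y` is active. -/
def activeCount (D X Y : Finset ℕ) : ℕ :=
  #{j ∈ X | (∃ t ∈ Y, t < j) ∧ ∀ t ∈ Y, t ∈ D → j < t}

/-- `rsb + bInv` for lists of blocks. -/
def invStat (D : Finset ℕ) (s : List (Finset ℕ)) : ℕ :=
  s.pairSum (activeCount D) + s.pairSum fun X Y => if Above D X Y then 1 else 0

/-- `rsb + bMaj` for lists of blocks. -/
def majStat (D : Finset ℕ) (s : List (Finset ℕ)) : ℕ :=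
  s.pairSum (activeCount D) + s.major (Above D)

/-- `s` lists the blocks of an ordered partition of `[n]`, some of which may be active, such that
`A` contains exactly the least elements of the blocks, and `D` only greatest elements. -/
structure Valid (A D : Finset ℕ) (n : ℕ) (s : List (Finset ℕ)) : Prop where
  pairwise : s.Pairwise Disjoint
  mem_iff : ∀ t, (∃ X ∈ s, t ∈ X) ↔ 1 ≤ t ∧ t ≤ n
  nonempty : ∀ X ∈ s, X.Nonempty
  opener : ∀ X ∈ s, ∀ t ∈ X, (t ∈ A ↔ ∀ u ∈ X, t ≤ u)
  closer : ∀ X ∈ s, ∀ t ∈ X, t ∈ D → ∀ u ∈ X, u ≤ t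

variable {A D : Finset ℕ} {n : ℕ} {s l l₁ l₂ : List (Finset ℕ)} {X : Finset ℕ}

/-! ### Adding and removing the largest element -/

theorem Valid.le (h : Valid A D n s) (hX : X ∈ s) {t : ℕ} (ht : t ∈ X) : t ≤ n :=
  ((h.mem_iff t).1 ⟨X, hX, ht⟩).2

theorem Valid.succ_notMem (h : Valid A D n s) (hX : X ∈ s) : n + 1 ∉ X := fun ht => by
  have := h.le hX ht
  omega

/-- Validity ignores the order of the blocks, so insertion and removal need checking only at the
head of the list. -/
theorem Valid.perm (h : Valid A D n s) (hs : s.Perm l) : Valid A D n l where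
  pairwise := (hs.pairwise_iff fun h => Disjoint.symm h).1 h.pairwise
  mem_iff t := by simpa only [hs.mem_iff] using h.mem_iff t
  nonempty X hX := h.nonempty X (hs.mem_iff.2 hX)
  opener X hX := h.opener X (hs.mem_iff.2 hX)
  closer X hX := h.closer X (hs.mem_iff.2 hX)

theorem valid_zero_iff : Valid A D 0 s ↔ s = [] := by
  refine ⟨fun h => List.eq_nil_iff_forall_not_mem.2 fun X hX => ?_, ?_⟩
  · obtain ⟨t, ht⟩ := h.nonempty X hX
    have := (h.mem_iff t).1 ⟨X, hX, ht⟩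
    omega
  · rintro rfl
    exact ⟨by simp, by simp; omega, by simp, by simp, by simp⟩

theorem Valid.cons_singleton (hA : n + 1 ∈ A) (h : Valid A D n l) :
    Valid A D (n + 1) ({n + 1} :: l) where
  pairwise := by
    refine List.pairwise_cons.2 ⟨fun X hX => ?_, h.pairwise⟩
    simpa using h.succ_notMem hX
  mem_iff t := by
    simp only [List.mem_cons, exists_eq_or_imp, mem_singleton, h.mem_iff]
    omega
  nonempty := by simpa using h.nonempty
  opener := by simpa [hA] using h.opener
  closer := by simpa using h.closer

theorem Valid.of_cons_singleton (h : Valid A D (n + 1) ({n + 1} :: l)) : Valid A D n l where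
  pairwise := (List.pairwise_cons.1 h.pairwise).2
  mem_iff t := by
    have h1 := h.mem_iff t
    simp only [List.mem_cons, exists_eq_or_imp, mem_singleton] at h1
    have h2 : ∀ X ∈ l, n + 1 ∉ X := by
      simpa using (List.pairwise_cons.1 h.pairwise).1
    constructor
    · rintro ⟨X, hX, ht⟩
      have := h1.1 (Or.inr ⟨X, hX, ht⟩)
      have : t ≠ n + 1 := by rintro rfl; exact h2 X hX ht
      omega
    · intro ht
      rcases h1.2 (by omega) with h | h
      · omega
      · exact h
  nonempty X hX := h.nonempty X (by simp [hX])
  opener X hX := h.opener X (by simp [hX])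
  closer X hX := h.closer X (by simp [hX])

theorem Valid.cons_insert (hA : n + 1 ∉ A) (h : Valid A D n (X :: l)) (hX : ¬ Closed D X) :
    Valid A D (n + 1) (insert (n + 1) X :: l) where
  pairwise := by
    have hp := List.pairwise_cons.1 h.pairwise
    refine List.pairwise_cons.2 ⟨fun Y hY => ?_, hp.2⟩
    exact Finset.disjoint_insert_left.2 ⟨h.succ_notMem (by simp [hY]), hp.1 Y hY⟩
  mem_iff t := by
    have := h.mem_iff t
    simp only [List.mem_cons, exists_eq_or_imp, mem_insert] at this ⊢
    rw [or_assoc, this]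
    omega
  nonempty := by
    have := h.nonempty
    simp only [List.mem_cons, forall_eq_or_imp] at this ⊢
    exact ⟨by simp, this.2⟩
  opener := by
    have ho := h.opener
    have hle : ∀ t ∈ X, t ≤ n := fun t => h.le (by simp)
    obtain ⟨u, hu⟩ := h.nonempty X (by simp)
    simp only [List.mem_cons, forall_eq_or_imp] at ho ⊢
    refine ⟨fun t ht => ?_, ho.2⟩
    rcases mem_insert.1 ht with rfl | ht
    · simp only [hA, false_iff, not_forall]
      exact ⟨u, mem_insert_of_mem hu, by have := hle u hu; omega⟩
    · rw [ho.1 t ht]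
      have := hle t ht
      simp only [mem_insert, forall_eq_or_imp]
      exact ⟨fun h => ⟨by omega, h⟩, fun h => h.2⟩
  closer := by
    have hc := h.closer
    have hle : ∀ t ∈ X, t ≤ n := fun t => h.le (by simp)
    simp only [List.mem_cons, forall_eq_or_imp] at hc ⊢
    refine ⟨fun t ht htD u hu => ?_, hc.2⟩
    rcases mem_insert.1 ht with rfl | ht
    · rcases mem_insert.1 hu with rfl | hu
      · rfl
      · have := hle u hu
        omega
    · exact absurd ⟨t, ht, htD⟩ hX

theorem Valid.of_cons_insert (hA : n + 1 ∉ A) (hm : n + 1 ∉ X)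
    (h : Valid A D (n + 1) (insert (n + 1) X :: l)) : Valid A D n (X :: l) ∧ ¬ Closed D X := by
  have hp := List.pairwise_cons.1 h.pairwise
  have h2 : ∀ Y ∈ l, n + 1 ∉ Y := fun Y hY => (Finset.disjoint_insert_left.1 (hp.1 Y hY)).1
  have hle : ∀ t ∈ X, t ≤ n := fun t ht => by
    have := h.le (X := insert (n + 1) X) (by simp) (mem_insert_of_mem ht)
    have : t ≠ n + 1 := by rintro rfl; exact hm ht
    omega
  have ho := h.opener
  have hc := h.closer
  have hn := h.nonempty
  simp only [List.mem_cons, forall_eq_or_imp] at ho hc hn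
  refine ⟨⟨?_, fun t => ?_, ?_, ?_, ?_⟩, ?_⟩
  · exact List.pairwise_cons.2
      ⟨fun Y hY => (Finset.disjoint_insert_left.1 (hp.1 Y hY)).2, hp.2⟩
  · have h1 := h.mem_iff t
    simp only [List.mem_cons, exists_eq_or_imp, mem_insert] at h1 ⊢
    constructor
    · rintro (ht | ⟨Y, hY, ht⟩)
      · have := h1.1 (Or.inl (Or.inr ht))
        have := hle t ht
        omega
      · have := h1.1 (Or.inr ⟨Y, hY, ht⟩)
        have : t ≠ n + 1 := by rintro rfl; exact h2 Y hY ht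
        omega
    · intro ht
      rcases h1.2 (by omega) with (h | h) | h
      · omega
      · exact Or.inl h
      · exact Or.inr h
  · simp only [List.mem_cons, forall_eq_or_imp]
    refine ⟨?_, hn.2⟩
    rw [nonempty_iff_ne_empty]
    rintro rfl
    exact hA ((ho.1 (n + 1) (by simp)).2 (by simp))
  · simp only [List.mem_cons, forall_eq_or_imp]
    refine ⟨fun t ht => ?_, ho.2⟩
    rw [ho.1 t (mem_insert_of_mem ht)]
    have := hle t ht
    simp only [mem_insert, forall_eq_or_imp]
    exact ⟨fun h => h.2, fun h => ⟨by omega, h⟩⟩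
  · simp only [List.mem_cons, forall_eq_or_imp]
    exact ⟨fun t ht htD u hu =>
      hc.1 t (mem_insert_of_mem ht) htD u (mem_insert_of_mem hu), hc.2⟩
  · rintro ⟨t, ht, htD⟩
    have := hc.1 t (mem_insert_of_mem ht) htD (n + 1) (mem_insert_self _ _)
    have := hle t ht
    omega

theorem Valid.insert_singleton (hA : n + 1 ∈ A) (h : Valid A D n (l₁ ++ l₂)) :
    Valid A D (n + 1) (l₁ ++ {n + 1} :: l₂) :=
  (h.cons_singleton hA).perm List.perm_middle.symm

theorem Valid.insert_mem (hA : n + 1 ∉ A) (h : Valid A D n (l₁ ++ X :: l₂)) (hX : ¬ Closed D X) :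
    Valid A D (n + 1) (l₁ ++ insert (n + 1) X :: l₂) :=
  ((h.perm List.perm_middle).cons_insert hA hX).perm List.perm_middle.symm

theorem Valid.exists_singleton (hA : n + 1 ∈ A) (h : Valid A D (n + 1) s) :
    ∃ l₁ l₂, s = l₁ ++ {n + 1} :: l₂ ∧ Valid A D n (l₁ ++ l₂) := by
  obtain ⟨Z, hZ, hm⟩ := (h.mem_iff (n + 1)).2 (by omega)
  -- As an opener `n + 1` is the least element of its block, and it is also the largest element
  -- overall.
  have hZ' : Z = {n + 1} := by
    ext t
    rw [mem_singleton]
    refine ⟨fun ht => ?_, fun ht => ht ▸ hm⟩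
    have h1 := h.le hZ ht
    have h2 := (h.opener Z hZ _ hm).1 hA t ht
    omega
  subst hZ'
  obtain ⟨l₁, l₂, rfl⟩ := List.append_of_mem hZ
  exact ⟨l₁, l₂, rfl, (h.perm List.perm_middle).of_cons_singleton⟩

theorem Valid.exists_insert (hA : n + 1 ∉ A) (h : Valid A D (n + 1) s) :
    ∃ l₁ X l₂, s = l₁ ++ insert (n + 1) X :: l₂ ∧ Valid A D n (l₁ ++ X :: l₂) ∧ ¬ Closed D X := by
  obtain ⟨Z, hZ, hm⟩ := (h.mem_iff (n + 1)).2 (by omega)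
  obtain ⟨l₁, l₂, rfl⟩ := List.append_of_mem hZ
  have h' := h.perm List.perm_middle
  rw [← insert_erase hm] at h'
  obtain ⟨h1, h2⟩ := h'.of_cons_insert hA (notMem_erase _ _)
  exact ⟨l₁, Z.erase (n + 1), l₂, by rw [insert_erase hm], h1.perm List.perm_middle.symm, h2⟩

/-- The numbers of blocks and of active blocks depend only on `A`, `D` and `n`. -/
theorem exists_length_countP (A D : Finset ℕ) (n : ℕ) :
    ∃ L a, ∀ s, Valid A D n s → s.length = L ∧ s.countP (¬ Closed D ·) = a := by
  induction n with
  | zero => exact ⟨0, 0, fun s hs => by simp [valid_zero_iff.1 hs]⟩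
  | succ n ih =>
    obtain ⟨L, a, ih⟩ := ih
    by_cases hA : n + 1 ∈ A
    · refine ⟨L + 1, a + if n + 1 ∈ D then 0 else 1, fun s hs => ?_⟩
      obtain ⟨l₁, l₂, rfl, h⟩ := hs.exists_singleton hA
      obtain ⟨rfl, rfl⟩ := ih _ h
      simp [Closed, List.countP_cons]
      split_ifs <;> simp_all <;> omega
    -- The enlarged block was active, so `a` is positive whenever such a list exists and the
    -- subtraction is not truncated.
    · refine ⟨L, a - 1 + if n + 1 ∈ D then 0 else 1, fun s hs => ?_⟩
      obtain ⟨l₁, X, l₂, rfl, h, hX⟩ := hs.exists_insert hA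
      obtain ⟨rfl, rfl⟩ := ih _ h
      have : Closed D (insert (n + 1) X) ↔ n + 1 ∈ D := by
        refine ⟨fun ⟨t, ht, htD⟩ => ?_, fun h => ⟨n + 1, mem_insert_self _ _, h⟩⟩
        rcases mem_insert.1 ht with rfl | ht
        · exact htD
        · exact absurd ⟨t, ht, htD⟩ hX
      simp [List.countP_cons, hX, this]
      (split_ifs <;> simp_all); omega

/-! ### Effect of an insertion on the statistics -/

theorem sum_map_indicator {α : Type*} (P : α → Prop) [DecidablePred P] (l : List α) :
    (l.map fun x => if P x then 1 else 0).sum = l.countP (P ·) := by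
  induction l with
  | nil => rfl
  | cons x l ih => by_cases h : P x <;> simp [h, ih, add_comm]

theorem sum_map_eq_zero {α : Type*} {f : α → ℕ} {l : List α} (h : ∀ x ∈ l, f x = 0) :
    (l.map f).sum = 0 := List.sum_eq_zero (by simpa using h)

theorem above_singleton (h : Valid A D n s) (hX : X ∈ s) :
    ¬ Above D X {n + 1} ∧ (Above D {n + 1} X ↔ Closed D X) := by
  have hle : ∀ t ∈ X, t ≤ n := fun t => h.le hX
  constructor
  · rintro ⟨-, h'⟩
    obtain ⟨x, hx⟩ := h.nonempty X hX
    have := h' x hx (n + 1) (by simp)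
    have := hle x hx
    omega
  · refine ⟨fun h => h.1, fun h => ⟨h, fun x hx y hy => ?_⟩⟩
    have := hle y hy
    simp only [mem_singleton] at hx
    omega

theorem activeCount_singleton_right (h : Valid A D n s) (hX : X ∈ s) :
    activeCount D X {n + 1} = 0 := by
  have hle : ∀ t ∈ X, t ≤ n := fun t => h.le hX
  simp only [activeCount, card_eq_zero, filter_eq_empty_iff]
  rintro j hj ⟨⟨t, ht, htj⟩, -⟩
  have := hle j hj
  simp only [mem_singleton] at ht
  omega

theorem succ_active_iff (h : Valid A D n s) {Y : Finset ℕ} (hY : Y ∈ s) :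
    ((∃ t ∈ Y, t < n + 1) ∧ ∀ t ∈ Y, t ∈ D → n + 1 < t) ↔ ¬ Closed D Y := by
  obtain ⟨y, hy⟩ := h.nonempty Y hY
  constructor
  · rintro ⟨-, h'⟩ ⟨t, ht, htD⟩
    have := h' t ht htD
    have := h.le hY ht
    omega
  · intro h'
    refine ⟨⟨y, hy, ?_⟩, fun t ht htD => absurd ⟨t, ht, htD⟩ h'⟩
    have := h.le hY hy
    omega

theorem activeCount_singleton_left (h : Valid A D n s) (hX : X ∈ s) :
    activeCount D {n + 1} X = if ¬ Closed D X then 1 else 0 := by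
  rw [activeCount, filter_singleton]
  simp only [succ_active_iff h hX]
  split_ifs <;> rfl

theorem pairSum_activeCount_singleton (h : Valid A D n (l₁ ++ l₂)) :
    (l₁ ++ {n + 1} :: l₂).pairSum (activeCount D) =
      (l₁ ++ l₂).pairSum (activeCount D) + l₂.countP (¬ Closed D ·) := by
  rw [List.pairSum_append_cons, sum_map_eq_zero (l := l₁), ← sum_map_indicator, zero_add]
  · congr 2
    exact List.map_congr_left fun Y hY => activeCount_singleton_left h (by simp [hY])
  · exact fun Y hY => activeCount_singleton_right h (by simp [hY])

/-- Each block to the right counts once: as active at `n + 1`, or else as closed and hence below `{n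
+ 1}`. -/
theorem invStat_singleton (h : Valid A D n (l₁ ++ l₂)) :
    invStat D (l₁ ++ {n + 1} :: l₂) = invStat D (l₁ ++ l₂) + l₂.length := by
  have h1 : (l₂.map fun Y => if Above D {n + 1} Y then 1 else 0).sum = l₂.countP (Closed D ·) := by
    rw [← sum_map_indicator]
    congr 1
    refine List.map_congr_left fun Y hY => ?_
    simp only [(above_singleton h (X := Y) (by simp [hY])).2]
  have h2 : (l₁.map fun Y => if Above D Y {n + 1} then 1 else 0).sum = 0 :=
    sum_map_eq_zero fun Y hY => if_neg (above_singleton h (X := Y) (by simp [hY])).1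
  have h3 := List.length_eq_countP_add_countP (Closed D ·) (l := l₂)
  have h4 := pairSum_activeCount_singleton h
  rw [invStat, invStat, h4, List.pairSum_append_cons, h1, h2]
  simp only [decide_eq_true_eq] at h3
  omega

/-- The only new contributions come from the element `n + 1`. Even if it closes `X`, the activity of
`X` at elements up to `n` is unchanged. -/
theorem pairSum_activeCount_insert (h : Valid A D n (l₁ ++ X :: l₂)) :
    (l₁ ++ insert (n + 1) X :: l₂).pairSum (activeCount D) =
      (l₁ ++ X :: l₂).pairSum (activeCount D) + l₂.countP (¬ Closed D ·) := by
  have h1 : (l₁.map (activeCount D · (insert (n + 1) X))) = l₁.map (activeCount D · X) := by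
    refine List.map_congr_left fun Y hY => ?_
    have hle : ∀ t ∈ Y, t ≤ n := fun t => h.le (by simp [hY])
    unfold activeCount
    congr 1
    refine filter_congr fun j hj => ?_
    have := hle j hj
    simp only [mem_insert, exists_eq_or_imp, forall_eq_or_imp]
    constructor
    · rintro ⟨h | h, -, h'⟩
      · omega
      · exact ⟨h, h'⟩
    · rintro ⟨h, h'⟩
      exact ⟨Or.inr h, fun _ => by omega, h'⟩
  have h2 : (l₂.map (activeCount D (insert (n + 1) X))).sum =
      (l₂.map (activeCount D X)).sum + l₂.countP (¬ Closed D ·) := by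
    rw [← sum_map_indicator, ← List.sum_map_add]
    congr 1
    refine List.map_congr_left fun Y hY => ?_
    rw [activeCount, filter_insert]
    simp only [succ_active_iff h (Y := Y) (by simp [hY])]
    split_ifs with hc
    · rfl
    · rw [card_insert_of_notMem, activeCount]
      simp [h.succ_notMem (X := X) (by simp)]
  rw [List.pairSum_append_cons, List.pairSum_append_cons, h1, h2]
  omega

/-- Both sides are false: `X` is not closed, and no element of `Y` exceeds `n + 1`. -/
theorem above_insert_right (h : Valid A D n (l₁ ++ X :: l₂)) (hX : ¬ Closed D X) {Y : Finset ℕ}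
    (hY : Y ∈ l₁) : Above D Y X ↔ Above D Y (insert (n + 1) X) := by
  refine ⟨fun h => absurd h.1 hX, fun h' => ?_⟩
  obtain ⟨y, hy⟩ := h.nonempty Y (by simp [hY])
  have := h'.2 y hy (n + 1) (by simp)
  have := h.le (X := Y) (by simp [hY]) hy
  omega

theorem above_insert_left (h : Valid A D n (l₁ ++ X :: l₂)) {Y : Finset ℕ}
    (hY : Y ∈ l₂) : Above D X Y ↔ Above D (insert (n + 1) X) Y := by
  simp only [Above, mem_insert, forall_eq_or_imp]
  refine ⟨fun h' => ⟨h'.1, fun y hy => ?_, h'.2⟩, fun h' => ⟨h'.1, h'.2.2⟩⟩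
  have := h.le (X := Y) (by simp [hY]) hy
  omega

theorem invStat_insert (h : Valid A D n (l₁ ++ X :: l₂)) (hX : ¬ Closed D X) :
    invStat D (l₁ ++ insert (n + 1) X :: l₂) =
      invStat D (l₁ ++ X :: l₂) + l₂.countP (¬ Closed D ·) := by
  have h1 : l₁.map (fun Y => if Above D Y X then 1 else 0) =
      l₁.map (fun Y => if Above D Y (insert (n + 1) X) then 1 else 0) :=
    List.map_congr_left fun Y hY => by simp only [above_insert_right h hX hY]
  have h2 : l₂.map (fun Y => if Above D X Y then 1 else 0) =
      l₂.map (fun Y => if Above D (insert (n + 1) X) Y then 1 else 0) :=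
    List.map_congr_left fun Y hY => by simp only [above_insert_left h hY]
  rw [invStat, invStat, pairSum_activeCount_insert h,
    List.pairSum_append_cons fun X Y => if Above D X Y then 1 else 0,
    List.pairSum_append_cons fun X Y => if Above D X Y then 1 else 0, h1, h2]
  omega

theorem majStat_insert (h : Valid A D n (l₁ ++ X :: l₂)) (hX : ¬ Closed D X) :
    majStat D (l₁ ++ insert (n + 1) X :: l₂) =
      majStat D (l₁ ++ X :: l₂) + l₂.countP (¬ Closed D ·) := by
  rw [majStat, majStat, pairSum_activeCount_insert h,
    List.major_replace (R := Above D) (x := X) l₁ l₂ (fun Y hY => above_insert_right h hX hY)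
      fun Y hY => above_insert_left h hY]
  omega

/-! ### Insertion bijections and equidistribution on lists -/

theorem exists_equiv_of_mem (hA : n + 1 ∈ A) :
    ∃ N, ∃ c c' : {s // Valid A D n s} × Fin N ≃ {s // Valid A D (n + 1) s}, ∀ s j,
      invStat D (c (s, j)) = invStat D s.1 + j ∧ majStat D (c' (s, j)) = majStat D s.1 + j := by
  obtain ⟨L, a, hL⟩ := exists_length_countP A D n
  have hlen : ∀ s : {s // Valid A D n s}, s.1.length = L := fun s => (hL s.1 s.2).1
  let c₀ : {s // Valid A D n s} × Fin (L + 1) → {s // Valid A D (n + 1) s} := fun p =>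
    ⟨p.1.1.take p.2 ++ {n + 1} :: p.1.1.drop p.2,
      Valid.insert_singleton hA (by rw [List.take_append_drop]; exact p.1.2)⟩
  have hc₀ : Function.Bijective c₀ := by
    constructor
    · rintro ⟨⟨s, hs⟩, p⟩ ⟨⟨s', hs'⟩, p'⟩ h
      have hp : p.1 ≤ s.length := by have := hlen ⟨s, hs⟩; dsimp only at this; omega
      have hp' : p'.1 ≤ s'.length := by have := hlen ⟨s', hs'⟩; dsimp only at this; omega
      obtain ⟨h1, -, h2⟩ := List.split_unique (n + 1 ∈ ·) (congrArg Subtype.val h) (by simp)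
        (by simp) (fun Y hY => hs.succ_notMem (List.mem_of_mem_take hY))
        (fun Y hY => hs'.succ_notMem (List.mem_of_mem_take hY))
      have h3 : s = s' := by
        rw [← List.take_append_drop p.1 s, ← List.take_append_drop p'.1 s']
        exact congrArg₂ _ h1 h2
      have h4 : p.1 = p'.1 := by
        have := congrArg List.length h1
        simp only [List.length_take] at this
        omega
      subst h3
      rw [Fin.ext h4]
    · rintro ⟨s, hs⟩
      obtain ⟨l₁, l₂, rfl, h⟩ := hs.exists_singleton hA
      refine ⟨(⟨_, h⟩, ⟨l₁.length, ?_⟩), ?_⟩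
      · have := hlen ⟨_, h⟩
        simp only [List.length_append] at this
        omega
      · simp [c₀]
  have hmaj : ∀ s : {s // Valid A D n s}, ∃ g : Equiv.Perm (Fin (L + 1)), ∀ j,
      List.major (Above D) (s.1.take (g j) ++ {n + 1} :: s.1.drop (g j)) +
        (s.1.drop (g j)).countP (¬ Closed D ·) = List.major (Above D) s.1 + j := fun s =>
    List.exists_perm_major (Closed D) {n + 1} (fun x y h => h.1) s.1
      (fun X hX => above_singleton s.2 hX) (by rw [hlen])
  choose g hg using hmaj
  -- Slot `p` has `L - p` blocks to its right, so reversal indexes the slots by the rise of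
  -- `invStat`. For `majStat` the Carlitz permutation, which depends on `s`, does so.
  refine ⟨L + 1, (Equiv.prodShear (Equiv.refl _) fun _ => Fin.revPerm).trans (.ofBijective c₀ hc₀),
    (Equiv.prodShear (Equiv.refl _) g).trans (.ofBijective c₀ hc₀), fun s j => ⟨?_, ?_⟩⟩
  · have h : Valid A D n (s.1.take (Fin.rev j) ++ s.1.drop (Fin.rev j)) := by
      rw [List.take_append_drop]; exact s.2
    have := invStat_singleton h
    rw [List.take_append_drop, List.length_drop, hlen] at this
    simp only [Equiv.trans_apply, Equiv.prodShear_apply, Equiv.refl_apply, Fin.revPerm_apply,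
      Equiv.ofBijective_apply, c₀]
    rw [this, Fin.val_rev]
    omega
  · have h : Valid A D n (s.1.take (g s j) ++ s.1.drop (g s j)) := by
      rw [List.take_append_drop]; exact s.2
    have h1 := pairSum_activeCount_singleton h
    have h2 := hg s j
    rw [List.take_append_drop] at h1
    simp only [Equiv.trans_apply, Equiv.prodShear_apply, Equiv.refl_apply,
      Equiv.ofBijective_apply, c₀, majStat]
    omega

/-- The active block receiving `n + 1` is indexed by the number of active blocks to its right, which
is the rise of both statistics. One bijection therefore serves both. -/
theorem exists_equiv_of_notMem (hA : n + 1 ∉ A) :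
    ∃ N, ∃ c : {s // Valid A D n s} × Fin N ≃ {s // Valid A D (n + 1) s}, ∀ s j,
      invStat D (c (s, j)) = invStat D s.1 + j ∧ majStat D (c (s, j)) = majStat D s.1 + j := by
  obtain ⟨L, a, hL⟩ := exists_length_countP A D n
  have hact : ∀ s : {s // Valid A D n s}, s.1.countP (¬ Closed D ·) = a := fun s => (hL s.1 s.2).2
  have key : ∀ p : {s // Valid A D n s} × Fin a, ∃ l₁ X l₂, p.1.1 = l₁ ++ X :: l₂ ∧
      ¬ Closed D X ∧ l₂.countP (¬ Closed D ·) = p.2 := fun p =>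
    List.exists_split_countP (¬ Closed D ·) p.1.1 p.2 (by rw [hact]; exact p.2.2)
  choose l₁ X l₂ hs hX hj using key
  have hv : ∀ p, Valid A D n (l₁ p ++ X p :: l₂ p) := fun p => hs p ▸ p.1.2
  let c : {s // Valid A D n s} × Fin a → {s // Valid A D (n + 1) s} := fun p =>
    ⟨l₁ p ++ insert (n + 1) (X p) :: l₂ p, (hv p).insert_mem hA (hX p)⟩
  have hc : Function.Bijective c := by
    constructor
    · rintro p p' h
      obtain ⟨h1, h2, h3⟩ := List.split_unique (n + 1 ∈ ·) (congrArg Subtype.val h) (by simp)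
        (by simp) (fun Y hY => (hv p).succ_notMem (by simp [hY]))
        (fun Y hY => (hv p').succ_notMem (by simp [hY]))
      have h4 : X p = X p' := by
        rw [← erase_insert ((hv p).succ_notMem (X := X p) (by simp)), h2,
          erase_insert ((hv p').succ_notMem (X := X p') (by simp))]
      refine Prod.ext (Subtype.ext ?_) (Fin.ext ?_)
      · rw [hs p, hs p', h1, h3, h4]
      · rw [← hj p, ← hj p', h3]
    · rintro ⟨s, hs'⟩
      obtain ⟨m₁, Y, m₂, rfl, h, hY⟩ := hs'.exists_insert hA
      have hlt : m₂.countP (¬ Closed D ·) < a := by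
        have := hact ⟨_, h⟩
        simp [hY] at this
        simp
        omega
      refine ⟨(⟨_, h⟩, ⟨_, hlt⟩), Subtype.ext ?_⟩
      obtain ⟨h1, h2, h3⟩ := List.split_countP_unique (¬ Closed D ·)
        (hs (⟨_, h⟩, ⟨_, hlt⟩)) hY (hX _) (hj (⟨_, h⟩, ⟨_, hlt⟩)).symm
      simp only [c]
      rw [← h1, ← h2, ← h3]
  refine ⟨a, .ofBijective c hc, fun s j => ?_⟩
  have h1 := invStat_insert (hv (s, j)) (hX _)
  have h2 := majStat_insert (hv (s, j)) (hX _)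
  rw [← hs, hj] at h1 h2
  exact ⟨h1, h2⟩

/-- The statistics `rsb + bInv` and `rsb + bMaj` are equidistributed on valid lists. -/
theorem exists_equiv_invStat_majStat (A D : Finset ℕ) (n : ℕ) :
    ∃ e : {s // Valid A D n s} ≃ {s // Valid A D n s}, ∀ s, invStat D (e s) = majStat D s.1 := by
  induction n with
  | zero =>
    refine ⟨Equiv.refl _, ?_⟩
    rintro ⟨s, hs⟩
    rw [valid_zero_iff] at hs
    subst hs
    rfl
  | succ n ih =>
    obtain ⟨e, he⟩ := ih
    obtain ⟨N, c, c', h⟩ :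
        ∃ N, ∃ c c' : {s // Valid A D n s} × Fin N ≃ {s // Valid A D (n + 1) s}, ∀ s j,
          invStat D (c (s, j)) = invStat D s.1 + j ∧
            majStat D (c' (s, j)) = majStat D s.1 + j := by
      by_cases hA : n + 1 ∈ A
      · exact exists_equiv_of_mem hA
      · obtain ⟨N, c, h⟩ := exists_equiv_of_notMem (D := D) hA
        exact ⟨N, c, c, h⟩
    -- Remove `n + 1` and record the rise of `majStat`, apply the bijection for `n`, then reinsert
    -- `n + 1` with the same rise of `invStat`.
    refine ⟨c'.symm.trans ((e.prodCongr (Equiv.refl _)).trans c), fun s => ?_⟩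
    obtain ⟨⟨s, j⟩, rfl⟩ := c'.surjective s
    simp only [Equiv.trans_apply, Equiv.symm_apply_apply, Equiv.prodCongr_apply, Prod.map_apply,
      Equiv.refl_apply]
    rw [(h _ _).1, (h _ _).2, he]

end BlockList

/-! ### List statistics as sums over positions -/

namespace List

variable {α : Type*}

theorem pairSum_ofFn (c : α → α → ℕ) {k : ℕ} (f : Fin k → α) :
    (ofFn f).pairSum c = ∑ a, ∑ b, if a < b then c (f a) (f b) else 0 := by
  induction k with
  | zero => simp [pairSum]
  | succ k ih =>
    rw [ofFn_succ, pairSum, ih, Fin.sum_univ_succ]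
    simp [Fin.sum_univ_succ, List.sum_ofFn]

/-- The weight `g` covers both uses: constant for the descent number, `i + 1` for the major index.
-/
theorem sum_descent_succ (R : α → α → Prop) [DecidableRel R] {k : ℕ} (f : Fin (k + 2) → α)
    (g : ℕ → ℕ) :
    (∑ a : Fin (k + 2), if ∃ b : Fin (k + 2), (b : ℕ) = a + 1 ∧ R (f a) (f b) then g a else 0) =
      (if R (f 0) (f 1) then g 0 else 0) +
        ∑ a : Fin (k + 1), if ∃ b : Fin (k + 1), (b : ℕ) = a + 1 ∧ R (f a.succ) (f b.succ)
          then g (a + 1) else 0 := by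
  rw [Fin.sum_univ_succ]
  congr 1
  · refine if_congr ⟨?_, fun h => ⟨1, rfl, h⟩⟩ rfl rfl
    rintro ⟨b, hb, h⟩
    have : b = 1 := Fin.ext (by simpa using hb)
    exact this ▸ h
  · refine sum_congr rfl fun a _ => ?_
    simp [Fin.exists_fin_succ]

theorem descents_ofFn (R : α → α → Prop) [DecidableRel R] {k : ℕ} (f : Fin k → α) :
    (ofFn f).descents R =
      ∑ a : Fin k, if ∃ b : Fin k, (b : ℕ) = a + 1 ∧ R (f a) (f b) then 1 else 0 := by
  induction k with
  | zero => simp [descents]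
  | succ k ih =>
    cases k with
    | zero => simp [descents]
    | succ k =>
      have := ih fun a => f a.succ
      rw [sum_descent_succ R f fun _ => 1, ← this]
      simp [ofFn_succ, descents]

theorem major_ofFn (R : α → α → Prop) [DecidableRel R] {k : ℕ} (f : Fin k → α) :
    (ofFn f).major R =
      ∑ a : Fin k, if ∃ b : Fin k, (b : ℕ) = a + 1 ∧ R (f a) (f b) then (a : ℕ) + 1 else 0 := by
  induction k with
  | zero => simp [major]
  | succ k ih =>
    cases k with
    | zero => simp [major]
    | succ k =>
      have h1 := ih fun a => f a.succ
      have h2 := descents_ofFn R fun a => f a.succ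
      have h3 : (ofFn f).major R = (if R (f 0) (f 1) then 1 else 0) +
          (ofFn fun a => f a.succ).descents R + (ofFn fun a => f a.succ).major R := by
        simp [ofFn_succ, major]
      rw [sum_descent_succ R f fun i => i + 1, h3, h1, h2, add_assoc, ← sum_add_distrib]
      congr 1
      refine sum_congr rfl fun a _ => ?_
      split_ifs <;> omega

end List

/-! ### Openers, closers and the type -/

namespace OrderedSetPartition

variable {n k : ℕ} (π : OrderedSetPartition n k)

theorem opener_mem (a : Fin k) : π.opener a ∈ π.block a := min'_mem _ _

theorem closer_mem (a : Fin k) : π.closer a ∈ π.block a := max'_mem _ _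

variable {π}

theorem opener_le {a : Fin k} {i : ℕ} (hi : i ∈ π.block a) : π.opener a ≤ i := min'_le _ _ hi

theorem le_closer {a : Fin k} {i : ℕ} (hi : i ∈ π.block a) : i ≤ π.closer a := le_max' _ _ hi

theorem eq_of_mem_block {a b : Fin k} {i : ℕ} (ha : i ∈ π.block a) (hb : i ∈ π.block b) :
    a = b := by
  by_contra h
  exact Finset.disjoint_left.1 (π.disjoint a b h) ha hb

theorem exists_mem_block_iff {i : ℕ} : (∃ a, i ∈ π.block a) ↔ i ∈ Icc 1 n := by
  rw [← π.union]
  simp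

theorem opener_injective : Function.Injective π.opener := fun a b h =>
  eq_of_mem_block (π.opener_mem a) (h ▸ π.opener_mem b)

theorem closer_injective : Function.Injective π.closer := fun a b h =>
  eq_of_mem_block (π.closer_mem a) (h ▸ π.closer_mem b)

theorem mem_openers_iff {a : Fin k} {i : ℕ} (hi : i ∈ π.block a) :
    i ∈ π.openers ↔ i = π.opener a := by
  simp only [openers, mem_image, mem_univ, true_and]
  constructor
  · rintro ⟨b, rfl⟩
    rw [eq_of_mem_block (π.opener_mem b) hi]
  · rintro rfl
    exact ⟨a, rfl⟩

theorem mem_closers_iff {a : Fin k} {i : ℕ} (hi : i ∈ π.block a) :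
    i ∈ π.closers ↔ i = π.closer a := by
  simp only [closers, mem_image, mem_univ, true_and]
  constructor
  · rintro ⟨b, rfl⟩
    rw [eq_of_mem_block (π.closer_mem b) hi]
  · rintro rfl
    exact ⟨a, rfl⟩

theorem openers_subset : π.openers ⊆ Icc 1 n := by
  simp only [openers, image_subset_iff, mem_univ, true_imp_iff]
  exact fun a => π.block_subset a (π.opener_mem a)

theorem closers_subset : π.closers ⊆ Icc 1 n := by
  simp only [closers, image_subset_iff, mem_univ, true_imp_iff]
  exact fun a => π.block_subset a (π.closer_mem a)

theorem opener_eq_closer_iff {a : Fin k} : π.opener a = π.closer a ↔ ¬ 1 < #(π.block a) := by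
  constructor
  · intro h h1
    obtain ⟨x, hx, y, hy, hxy⟩ := one_lt_card.1 h1
    have := opener_le hx
    have := opener_le hy
    have := le_closer hx
    have := le_closer hy
    omega
  · contrapose!
    exact fun h => one_lt_card.2 ⟨_, π.opener_mem a, _, π.closer_mem a, h⟩

theorem block_eq_singleton_iff {a : Fin k} {i : ℕ} :
    π.block a = {i} ↔ i = π.opener a ∧ i = π.closer a := by
  constructor
  · intro h
    have h1 := π.opener_mem a
    have h2 := π.closer_mem a
    rw [h, mem_singleton] at h1 h2
    exact ⟨h1.symm, h2.symm⟩
  · rintro ⟨h1, h2⟩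
    refine Finset.eq_singleton_iff_unique_mem.2 ⟨h1 ▸ π.opener_mem a, fun x hx => ?_⟩
    have := opener_le hx
    have := le_closer hx
    omega

theorem strictOpeners_eq : π.strictOpeners = π.openers \ π.closers := by
  ext i
  simp only [strictOpeners, mem_filter, mem_sdiff]
  constructor
  · rintro ⟨-, a, h, rfl⟩
    rw [mem_closers_iff (π.opener_mem a), mem_openers_iff (π.opener_mem a), opener_eq_closer_iff]
    exact ⟨rfl, not_not.2 h⟩
  · rintro ⟨h1, h2⟩
    obtain ⟨a, ha⟩ := π.exists_mem_block_iff.2 (openers_subset h1)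
    rw [mem_openers_iff ha] at h1
    subst h1
    rw [mem_closers_iff ha, opener_eq_closer_iff, not_not] at h2
    exact ⟨π.block_subset a ha, a, h2, rfl⟩

theorem strictClosers_eq : π.strictClosers = π.closers \ π.openers := by
  ext i
  simp only [strictClosers, mem_filter, mem_sdiff]
  constructor
  · rintro ⟨-, a, h, rfl⟩
    rw [mem_closers_iff (π.closer_mem a), mem_openers_iff (π.closer_mem a)]
    exact ⟨rfl, fun h' => opener_eq_closer_iff.1 h'.symm h⟩
  · rintro ⟨h1, h2⟩
    obtain ⟨a, ha⟩ := π.exists_mem_block_iff.2 (closers_subset h1)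
    rw [mem_closers_iff ha] at h1
    subst h1
    rw [mem_openers_iff ha, eq_comm, opener_eq_closer_iff, not_not] at h2
    exact ⟨π.block_subset a ha, a, h2, rfl⟩

theorem singletons_eq : π.singletons = π.openers ∩ π.closers := by
  ext i
  simp only [singletons, mem_filter, mem_inter, block_eq_singleton_iff]
  constructor
  · rintro ⟨-, a, rfl, h⟩
    rw [mem_closers_iff (π.opener_mem a), mem_openers_iff (π.opener_mem a)]
    exact ⟨rfl, h⟩
  · rintro ⟨h1, h2⟩
    obtain ⟨a, ha⟩ := π.exists_mem_block_iff.2 (openers_subset h1)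
    rw [mem_openers_iff ha] at h1
    rw [mem_closers_iff ha] at h2
    exact ⟨π.block_subset a ha, a, h1, h2⟩

theorem transients_eq : π.transients = Icc 1 n \ (π.openers ∪ π.closers) := by
  ext i
  simp only [transients, mem_filter, mem_sdiff, mem_union, not_or]
  refine and_congr_right fun hi => ?_
  obtain ⟨a, ha⟩ := π.exists_mem_block_iff.2 hi
  rw [mem_openers_iff ha, mem_closers_iff ha]
  constructor
  · rintro ⟨b, -, hb, h1, h2⟩
    rw [eq_of_mem_block ha hb]
    exact ⟨h1, h2⟩
  · rintro ⟨h1, h2⟩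
    exact ⟨a, one_lt_card.2 ⟨i, ha, _, π.opener_mem a, h1⟩, ha, h1, h2⟩

/-- Fixing the type amounts to fixing the sets of openers and of closers. -/
theorem type_eq_iff {ρ : OrderedSetPartition n k} :
    π.type = ρ.type ↔ π.openers = ρ.openers ∧ π.closers = ρ.closers := by
  constructor
  · intro h
    simp only [type, Prod.mk.injEq, strictOpeners_eq, strictClosers_eq, singletons_eq] at h
    obtain ⟨h1, h2, h3, -⟩ := h
    have h4 := sdiff_union_inter π.openers π.closers
    have h5 := sdiff_union_inter π.closers π.openers
    rw [h1, h3, sdiff_union_inter] at h4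
    rw [h2, inter_comm, h3, inter_comm, sdiff_union_inter] at h5
    exact ⟨h4.symm, h5.symm⟩
  · rintro ⟨h1, h2⟩
    simp only [type, strictOpeners_eq, strictClosers_eq, singletons_eq, transients_eq, h1, h2]

/-! ### Ordered partitions as valid lists -/

open BlockList

theorem valid_ofFn : Valid π.openers π.closers n (List.ofFn π.block) where
  pairwise := List.pairwise_ofFn.2 fun a b h => π.disjoint a b h.ne
  mem_iff t := by
    rw [← mem_Icc, ← π.exists_mem_block_iff]
    simp
  nonempty := by simpa using π.nonempty
  opener := by
    simp only [List.mem_ofFn, forall_exists_index, forall_apply_eq_imp_iff]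
    intro a t ht
    rw [mem_openers_iff ht]
    refine ⟨?_, fun h => le_antisymm (h _ (π.opener_mem a)) (opener_le ht)⟩
    rintro rfl u hu
    exact opener_le hu
  closer := by
    simp only [List.mem_ofFn, forall_exists_index, forall_apply_eq_imp_iff]
    intro a t ht h u hu
    rw [(mem_closers_iff ht).1 h]
    exact le_closer hu

theorem closed_block (a : Fin k) : Closed π.closers (π.block a) :=
  ⟨_, π.closer_mem a, (mem_closers_iff (π.closer_mem a)).2 rfl⟩

theorem exists_ofFn_eq {s : List (Finset ℕ)} (hs : Valid π.openers π.closers n s) :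
    ∃ ρ : OrderedSetPartition n k, ρ.type = π.type ∧ List.ofFn ρ.block = s := by
  obtain ⟨L, a, hL⟩ := exists_length_countP π.openers π.closers n
  obtain ⟨h1, h2⟩ := hL _ valid_ofFn
  obtain ⟨h3, h4⟩ := hL _ hs
  rw [List.length_ofFn] at h1
  have hlen : s.length = k := by omega
  -- The list of blocks of `π` has no active block, and the number of active blocks is the same for
  -- all valid lists; so every block of `s` is closed.
  have ha : a = 0 := by
    rw [← h2, List.countP_eq_zero]
    simp only [List.mem_ofFn, forall_exists_index, forall_apply_eq_imp_iff]
    intro b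
    simpa using closed_block b
  have hclosed : ∀ X ∈ s, Closed π.closers X := by
    rw [ha, List.countP_eq_zero] at h4
    simpa using h4
  obtain ⟨f, rfl⟩ : ∃ f : Fin k → Finset ℕ, List.ofFn f = s := by
    subst hlen
    exact ⟨s.get, List.ofFn_get s⟩
  have hmem : ∀ b, f b ∈ List.ofFn f := fun b => List.mem_ofFn.2 ⟨b, rfl⟩
  have hdisj : ∀ b c, b ≠ c → Disjoint (f b) (f c) := by
    intro b c hbc
    have := List.pairwise_ofFn.1 hs.pairwise
    rcases lt_or_gt_of_ne hbc with h | h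
    · exact this h
    · exact (this h).symm
  let ρ : OrderedSetPartition n k :=
    { block := f
      nonempty := fun b => hs.nonempty _ (hmem b)
      disjoint := hdisj
      union := by
        ext t
        rw [mem_Icc, ← hs.mem_iff]
        simp }
  refine ⟨ρ, type_eq_iff.2 ⟨?_, ?_⟩, rfl⟩
  · ext t
    by_cases ht : t ∈ Icc 1 n
    · obtain ⟨b, hb⟩ := ρ.exists_mem_block_iff.2 ht
      rw [mem_openers_iff hb, hs.opener _ (hmem b) t hb]
      refine ⟨?_, fun h => le_antisymm (h _ (ρ.opener_mem b)) (opener_le hb)⟩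
      rintro rfl u hu
      exact opener_le (π := ρ) hu
    · exact iff_of_false (fun h => ht (openers_subset h)) fun h => ht (openers_subset h)
  · ext t
    by_cases ht : t ∈ Icc 1 n
    · obtain ⟨b, hb⟩ := ρ.exists_mem_block_iff.2 ht
      rw [mem_closers_iff hb]
      constructor
      · rintro rfl
        obtain ⟨d, hd, hdD⟩ := hclosed _ (hmem b)
        have h1 := hs.closer _ (hmem b) d hd hdD _ hb
        have h2 := le_closer (π := ρ) hd
        rwa [le_antisymm h1 h2]
      · exact fun h => le_antisymm (le_closer hb) (hs.closer _ (hmem b) t hb h _ (ρ.closer_mem b))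
    · exact iff_of_false (fun h => ht (closers_subset h)) fun h => ht (closers_subset h)

/-! ### Reduction of the statistics to rsb -/

variable (π)

/-- `rsb = ∑ᵢ rsbᵢ`, where `rsbᵢ` counts the blocks to the right of the block containing `i`
whose opener is smaller than `i` and whose closer is greater than `i`. -/
def rsb : ℕ :=
  ∑ i ∈ Icc 1 n, #{a : Fin k | (∃ b, i ∈ π.block b ∧ b < a) ∧ π.opener a < i ∧ i < π.closer a}

variable {π}

theorem sum_Icc_eq (F : ℕ → ℕ) : ∑ i ∈ Icc 1 n, F i = ∑ a, ∑ i ∈ π.block a, F i := by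
  rw [← π.union, sum_biUnion]
  exact fun a _ b _ h => π.disjoint a b h

theorem exists_mem_block_and_iff {i : ℕ} {b : Fin k} (hi : i ∈ π.block b) (P : Fin k → Prop) :
    (∃ c, i ∈ π.block c ∧ P c) ↔ P b := by
  refine ⟨?_, fun h => ⟨b, hi, h⟩⟩
  rintro ⟨c, hc, h⟩
  exact eq_of_mem_block hi hc ▸ h

theorem leftOf_iff {i j : ℕ} {a b : Fin k} (hi : i ∈ π.block a) (hj : j ∈ π.block b) :
    π.LeftOf i j ↔ a < b := by
  refine ⟨?_, fun h => ⟨a, b, hi, hj, h⟩⟩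
  rintro ⟨c, d, hc, hd, h⟩
  rwa [eq_of_mem_block hi hc, eq_of_mem_block hj hd]

theorem card_filter_openers (P : ℕ → Prop) [DecidablePred P] :
    #{j ∈ π.openers | P j} = ∑ a, if P (π.opener a) then 1 else 0 := by
  rw [openers, filter_image, card_image_of_injective _ opener_injective, card_filter]

theorem card_filter_closers (P : ℕ → Prop) [DecidablePred P] :
    #{j ∈ π.closers | P j} = ∑ a, if P (π.closer a) then 1 else 0 := by
  rw [closers, filter_image, card_image_of_injective _ closer_injective, card_filter]

/-- A block to the right of `i` with opener below `i` either has its closer below `i` or is open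
across `i`. The former join the blocks of lcs to give all closers below `i`; the block of `i` itself
gives none. -/
theorem MAK_eq : π.MAK = ∑ i ∈ Icc 1 n, #{j ∈ π.closers | j < i} + π.rsb := by
  rw [MAK, ros, lcs, rsb, ← sum_add_distrib, ← sum_add_distrib]
  refine sum_congr rfl fun i hi => ?_
  obtain ⟨b, hb⟩ := π.exists_mem_block_iff.2 hi
  rw [card_filter_openers, card_filter_closers, card_filter_closers, card_filter,
    ← sum_add_distrib, ← sum_add_distrib]
  refine sum_congr rfl fun a _ => ?_
  simp only [leftOf_iff hb (π.opener_mem a), leftOf_iff (π.closer_mem a) hb,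
    exists_mem_block_and_iff hb]
  have h1 := le_closer (π.opener_mem a)
  have h2 : i = π.closer a → a = b := fun h => eq_of_mem_block (h ▸ π.closer_mem a) hb
  have h3 : a = b → i ≤ π.closer a := by rintro rfl; exact le_closer hb
  rcases lt_trichotomy a b with h | h | h
  · simp [h, h.not_gt]
  · have := h3 h
    simp [h, (h ▸ this).not_gt]
  · have := h.ne'
    simp only [h, h.not_gt, and_true, and_false, true_and, if_false]
    split_ifs <;> omega

/-- The mirror argument: a block to the right with closer above `i` either opens after `i` or is
open across `i`. -/
theorem MAK'_eq : π.MAK' = ∑ i ∈ Icc 1 n, #{j ∈ π.openers | i < j} + π.rsb := by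
  rw [MAK', lob, rcb, rsb, ← sum_add_distrib, ← sum_add_distrib]
  refine sum_congr rfl fun i hi => ?_
  obtain ⟨b, hb⟩ := π.exists_mem_block_iff.2 hi
  rw [card_filter_openers, card_filter_closers, card_filter_openers, card_filter,
    ← sum_add_distrib, ← sum_add_distrib]
  refine sum_congr rfl fun a _ => ?_
  simp only [leftOf_iff hb (π.closer_mem a), leftOf_iff (π.opener_mem a) hb,
    exists_mem_block_and_iff hb]
  have h1 := le_closer (π.opener_mem a)
  have h2 : i = π.opener a → a = b := fun h => eq_of_mem_block (h ▸ π.opener_mem a) hb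
  have h3 : a = b → π.opener a ≤ i := by rintro rfl; exact opener_le hb
  rcases lt_trichotomy a b with h | h | h
  · simp [h, h.not_gt]
  · have := h3 h
    simp [h, (h ▸ this).not_gt]
  · have := h.ne'
    simp only [h, h.not_gt, and_true, and_false, true_and, if_false]
    split_ifs <;> omega

/-- A block opened before `i` is open across `i` on the left or right, closed before `i`, or the
block of `i` itself. The last case occurs exactly when `i` is not an opener. -/
theorem lsb_add_rsb : π.lsb + π.rsb + ∑ i ∈ Icc 1 n, #{j ∈ π.closers | j < i} +
    ∑ i ∈ Icc 1 n, (if i ∈ π.openers then 0 else 1) =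
      ∑ i ∈ Icc 1 n, #{j ∈ π.openers | j < i} := by
  rw [lsb, rsb, ← sum_add_distrib, ← sum_add_distrib, ← sum_add_distrib]
  refine sum_congr rfl fun i hi => ?_
  obtain ⟨b, hb⟩ := π.exists_mem_block_iff.2 hi
  have h0 : (if i ∈ π.openers then 0 else 1) =
      ∑ a, if a = b then (if i = π.opener b then 0 else 1) else 0 := by
    rw [sum_ite_eq' univ b, if_pos (mem_univ b)]
    exact if_congr (mem_openers_iff hb) rfl rfl
  rw [card_filter_openers, card_filter_closers, card_filter, card_filter, h0,
    ← sum_add_distrib, ← sum_add_distrib, ← sum_add_distrib]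
  refine sum_congr rfl fun a _ => ?_
  simp only [exists_mem_block_and_iff hb]
  have h1 := le_closer (π.opener_mem a)
  have h2 : i = π.closer a → a = b := fun h => eq_of_mem_block (h ▸ π.closer_mem a) hb
  rcases lt_trichotomy a b with h | rfl | h
  · have := h.ne
    simp only [h, h.not_gt, this, true_and, false_and, if_false]
    split_ifs <;> omega
  · have := le_closer hb
    have := opener_le hb
    simp only [lt_irrefl, false_and, if_false, if_true]
    split_ifs <;> omega
  · have := h.ne'
    simp only [h, h.not_gt, this, true_and, false_and, if_false]
    split_ifs <;> omega

/-! ### Transfer of the bijection to ordered partitions -/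

theorem above_block_iff {a b : Fin k} :
    Above π.closers (π.block a) (π.block b) ↔ π.BlockGT a b := by
  constructor
  · exact fun h => h.2 _ (π.opener_mem a) _ (π.closer_mem b)
  · refine fun h => ⟨closed_block b, fun x hx y hy => ?_⟩
    have h : π.closer b < π.opener a := h
    have := opener_le hx
    have := le_closer hy
    omega

theorem activeCount_block (a b : Fin k) :
    activeCount π.closers (π.block a) (π.block b) =
      ∑ i ∈ π.block a, if π.opener b < i ∧ i < π.closer b then 1 else 0 := by
  rw [activeCount, card_filter]
  refine sum_congr rfl fun i hi => ?_
  refine if_congr (and_congr ⟨?_, fun h => ⟨_, π.opener_mem b, h⟩⟩ ⟨fun h => ?_, ?_⟩) rfl rfl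
  · rintro ⟨t, ht, h⟩
    exact (opener_le ht).trans_lt h
  · exact h _ (π.closer_mem b) ((mem_closers_iff (π.closer_mem b)).2 rfl)
  · intro h t ht htD
    rwa [(mem_closers_iff ht).1 htD]

theorem pairSum_activeCount_ofFn :
    (List.ofFn π.block).pairSum (activeCount π.closers) = π.rsb := by
  rw [List.pairSum_ofFn, rsb, π.sum_Icc_eq]
  refine sum_congr rfl fun a _ => ?_
  have h : ∀ i ∈ π.block a,
      #{c : Fin k | (∃ b, i ∈ π.block b ∧ b < c) ∧ π.opener c < i ∧ i < π.closer c} =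
        ∑ c, if a < c then (if π.opener c < i ∧ i < π.closer c then 1 else 0) else 0 := by
    intro i hi
    rw [card_filter]
    simp only [exists_mem_block_and_iff hi, ite_and]
  rw [sum_congr rfl h, sum_comm]
  refine sum_congr rfl fun b _ => ?_
  split_ifs
  · exact activeCount_block a b
  · simp

theorem invStat_ofFn : invStat π.closers (List.ofFn π.block) = π.rsb + π.bInv := by
  rw [invStat, pairSum_activeCount_ofFn, List.pairSum_ofFn, bInv, card_filter,
    Fintype.sum_prod_type]
  simp only [above_block_iff, ite_and]

theorem majStat_ofFn : majStat π.closers (List.ofFn π.block) = π.rsb + π.bMaj := by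
  rw [majStat, pairSum_activeCount_ofFn, List.major_ofFn, bMaj, sum_filter]
  simp only [above_block_iff]

/-- On the partitions of the type of `π`, taking the list of blocks is a bijection onto the valid
lists. -/
noncomputable def equivValid (π : OrderedSetPartition n k) :
    {ρ : OrderedSetPartition n k // ρ.type = π.type} ≃
      {s // Valid π.openers π.closers n s} :=
  .ofBijective
    (fun ρ => ⟨List.ofFn ρ.1.block, by
      obtain ⟨h1, h2⟩ := type_eq_iff.1 ρ.2
      rw [← h1, ← h2]
      exact valid_ofFn⟩)
    ⟨fun ρ σ h => Subtype.ext (OrderedSetPartition.ext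
        (List.ofFn_injective (congrArg Subtype.val h))),
      fun ⟨s, hs⟩ => by
        obtain ⟨ρ, h1, h2⟩ := exists_ofFn_eq hs
        exact ⟨⟨ρ, h1⟩, Subtype.ext h2⟩⟩

theorem exists_equiv_rsb (π : OrderedSetPartition n k) :
    ∃ e : {ρ : OrderedSetPartition n k // ρ.type = π.type} ≃
        {ρ : OrderedSetPartition n k // ρ.type = π.type},
      ∀ ρ, (e ρ).1.rsb + (e ρ).1.bInv = ρ.1.rsb + ρ.1.bMaj := by
  obtain ⟨e, he⟩ := exists_equiv_invStat_majStat π.openers π.closers n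
  refine ⟨π.equivValid.trans (e.trans π.equivValid.symm), fun ρ => ?_⟩
  have hval : ∀ σ, (π.equivValid σ).1 = List.ofFn σ.1.block := fun _ => rfl
  have hclos : ∀ σ : {ρ : OrderedSetPartition n k // ρ.type = π.type}, σ.1.closers = π.closers :=
    fun σ => (type_eq_iff.1 σ.2).2
  rw [← invStat_ofFn, ← majStat_ofFn, hclos, hclos, ← hval, ← hval, ← he]
  simp

end OrderedSetPartition

open OrderedSetPartition in
theorem theorem3p3 (n k : ℕ) (hk : 1 ≤ k) (hkn : k ≤ n)
    (lam : Finset ℕ × Finset ℕ × Finset ℕ × Finset ℕ) :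
    Equidistributed (orderedPartitionsOfType n k lam)
      (fun π => (π.MAK + π.bMaj, π.MAK' + π.bMaj, π.cmajLSB))
      (fun π => (π.MAK + π.bInv, π.MAK' + π.bInv, π.cinvLSB)) := by
  intro v
  by_cases hne : ∃ π : OrderedSetPartition n k, π.type = lam
  · obtain ⟨π, rfl⟩ := hne
    obtain ⟨e, he⟩ := exists_equiv_rsb π
    have key : ∀ ρ, ((e ρ).1.MAK + (e ρ).1.bInv, (e ρ).1.MAK' + (e ρ).1.bInv, (e ρ).1.cinvLSB) =
        (ρ.1.MAK + ρ.1.bMaj, ρ.1.MAK' + ρ.1.bMaj, ρ.1.cmajLSB) := by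
      intro ρ
      obtain ⟨h1, h2⟩ := type_eq_iff.1 ((e ρ).2.trans ρ.2.symm)
      have h3 := he ρ
      have h4 := (e ρ).1.lsb_add_rsb
      have h5 := ρ.1.lsb_add_rsb
      rw [h1, h2] at h4
      -- All remaining sums depend only on the common openers and closers, so each component follows
      -- from `h3`, the third also using `h4` and `h5`.
      rw [MAK_eq, MAK_eq, MAK'_eq, MAK'_eq, h1, h2, cinvLSB, cmajLSB, cbInv, cbMaj]
      refine Prod.ext ?_ (Prod.ext ?_ ?_)
      · dsimp only; omega
      · dsimp only; omega
      · dsimp only; omega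
    have hcard : ∀ f : OrderedSetPartition n k → ℕ × ℕ × ℤ,
        #{ρ ∈ orderedPartitionsOfType n k π.type | f ρ = v} =
          Fintype.card {ρ : {ρ : OrderedSetPartition n k // ρ.type = π.type} // f ρ.1 = v} := by
      intro f
      rw [orderedPartitionsOfType, filter_filter, ← Fintype.card_subtype]
      exact Fintype.card_congr (Equiv.subtypeSubtypeEquivSubtypeInter _ fun ρ => f ρ = v).symm
    rw [hcard, hcard]
    exact Fintype.card_congr (e.subtypeEquiv fun ρ => by rw [key])
  · have : orderedPartitionsOfType n k lam = ∅ := by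
      simpa [orderedPartitionsOfType, filter_eq_empty_iff] using hne
    simp [this]
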